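/- **Setting.** A dueling-reward bandit instance with $K\ge 1$ arms consists of pairwise distinct Bernoulli reward means $\mu_k\in(0,1)$ and dueling probabilities $\nu_{k,\ell}\in(0,1)$ with $\nu_{k,\ell}=1-\nu_{\ell,k}$ and $\nu_{k,\ell}>\tfrac12$ whenever $\mu_k>\mu_\ell$. For a given instance the arms are numbered so that $\mu_1>\mu_2>\dots>\mu_K$; this numbering is not known to the learner. Put $\Delta^R_k=\mu_1-\mu_k$ and $\Delta^D_k=\nu_{1,k}-\tfrac12$. In each round $t$ the learner chooses, possibly at random and depending on the past observations (and possibly on the horizon $T$), an arm $k_t$ and a pair $(k_{1,t},k_{2,t})$; it observes a Bernoulli($\mu_{k_t}$) reward and, independently, the winner of the duel, in which $k_{1,t}$ beats $k_{2,t}$ with probability $\nu_{k_{1,t},k_{2,t}}$. For $\alpha\in[0,1]$ the regret is $$R_T=\alpha\sum_{t=1}^T\Delta^R_{k_t}+(1-\alpha)\sum_{t=1}^T\frac{\Delta^D_{k_{1,t}}+\Delta^D_{k_{2,t}}}{2}.$$ Let $N_{k,T}$ be the number of rounds $t\le T$ with $k_t=k$, and $M_{k,\ell,T}$ the number of rounds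 $t\le T$ in which the pair $(k,\ell)$ or $(\ell,k)$ is chosen. An algorithm is *consistent* if on every instance, for every suboptimal arm $k\ne1$ and every $\gamma>0$, $\mathbb E[N_{k,T}]=o(T^\gamma)$ and $\mathbb E[M_{k,\ell,T}]=o(T^\gamma)$ for all $\ell\neq k$. Let $\mathrm{kl}(p,q)=p\log\frac pq+(1-p)\log\frac{1-p}{1-q}$. **Statement.** For every $\eta>0$ there is a constant $C>0$, depending only on $\eta$, such that the following holds for every $K\ge1$, every consistent algorithm, every $\alpha\in[0,1]$ and every instance with $\eta\le\mu_1\le1-\eta$. If for every suboptimal arm $k\ne1$ the most effective dueling competitor is the optimal arm, that is, $\ell=1$ minimizes $$\frac{\Delta^D_k+\Delta^D_\ell}{\mathrm{kl}(\nu_{k,\ell},\frac12)}$$ over all arms $\ell<k$, then $$\liminf_{T\to\infty}\frac{\mathbb E[R_T]}{\log T}\ \ge\ C\sum_{k\neq1}\frac{1}{\max\{\Delta^R_k/\alpha,\ \Delta^D_k/(1-\alpha)\}},$$ where $x/0=\infty$ for $x>0$ and $1/\infty=0$. -/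

import Mathlib

open Filter Asymptotics

namespace DRMAB

noncomputable section

/-- The Kullback--Leibler divergence between the Bernoulli distributions with means `p`, `q`. -/
def kl (p q : ℝ) : ℝ :=
  p * Real.log (p / q) + (1 - p) * Real.log ((1 - p) / (1 - q))

/-- A dueling-reward bandit instance with `K` arms: Bernoulli reward means `mean k` and dueling
probabilities `duel k l` (the probability that `k` beats `l`). The means are distinct; their order
is arbitrary, since the learner does not know which arm is the best one. -/
structure Instance (K : ℕ) where
  mean : Fin K → ℝ
  duel : Fin K → Fin K → ℝ
  mean_mem : ∀ k, mean k ∈ Set.Ioo (0 : ℝ) 1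
  mean_injective : Function.Injective mean
  duel_mem : ∀ k l, duel k l ∈ Set.Ioo (0 : ℝ) 1
  duel_symm : ∀ k l, duel k l = 1 - duel l k
  duel_gt : ∀ k l, mean l < mean k → 1 / 2 < duel k l

namespace Instance

variable {K : ℕ}

theorem exists_opt [NeZero K] (I : Instance K) : ∃ a, ∀ k, I.mean k ≤ I.mean a :=
  Finite.exists_max I.mean

/-- The optimal arm, i.e. the (unique) arm with the largest reward mean. -/
def opt [NeZero K] (I : Instance K) : Fin K :=
  I.exists_opt.choose

theorem mean_le_opt [NeZero K] (I : Instance K) (k : Fin K) : I.mean k ≤ I.mean I.opt :=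
  I.exists_opt.choose_spec k

/-- The reward gap of arm `k`. -/
def rewardGap [NeZero K] (I : Instance K) (k : Fin K) : ℝ :=
  I.mean I.opt - I.mean k

/-- The dueling gap of arm `k`. -/
def duelGap [NeZero K] (I : Instance K) (k : Fin K) : ℝ :=
  I.duel I.opt k - 1 / 2

/-- The cost per unit of information of exploring arm `k` by dueling it with arm `l`. -/
def duelCost [NeZero K] (I : Instance K) (k l : Fin K) : ℝ :=
  (I.duelGap k + I.duelGap l) / kl (I.duel k l) (1 / 2)

/-- Arm `l` is a most effective competitor for arm `k`: it minimizes the cost of dueling with `k`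
among all arms that are better than `k`. -/
def IsMostEffective [NeZero K] (I : Instance K) (k l : Fin K) : Prop :=
  I.mean k < I.mean l ∧ ∀ l', I.mean k < I.mean l' → I.duelCost k l ≤ I.duelCost k l'

end Instance

/-- The choice made in one round: an arm for reward feedback and a pair of arms to duel. -/
structure Action (K : ℕ) where
  arm : Fin K
  fst : Fin K
  snd : Fin K
  deriving DecidableEq, Fintype

/-- One round of interaction: the action, the Bernoulli reward, and the result of the duel
(`fstWins = true` if the first arm of the pair wins, `false` if the second one does). -/
structure Round (K : ℕ) where
  action : Action K
  reward : Bool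
  fstWins : Bool
  deriving DecidableEq, Fintype

/-- A (randomized) policy: it maps the history of the first `t` rounds to a distribution of the
action of the next round. -/
abbrev Policy (K : ℕ) : Type :=
  (t : ℕ) → (Fin t → Round K) → PMF (Action K)

/-- An algorithm gives a policy for each horizon `T`. Algorithms that do not use the horizon are
the constant families. -/
abbrev Algorithm (K : ℕ) : Type :=
  ℕ → Policy K

/-- The Bernoulli distribution with mean `p`. -/
def bernoulli (p : ℝ) (hp : p ∈ Set.Ioo (0 : ℝ) 1) : PMF Bool :=
  PMF.ofFintype (fun b => ENNReal.ofReal (if b then p else 1 - p)) (by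
    rw [Fintype.sum_bool, if_pos rfl, if_neg Bool.false_ne_true,
      ← ENNReal.ofReal_add hp.1.le (by linarith [hp.2])]
    simp)

/-- Distribution of a round, given the action: the reward and the duel are independent. -/
def feedback {K : ℕ} (I : Instance K) (a : Action K) : PMF (Round K) :=
  (bernoulli (I.mean a.arm) (I.mean_mem a.arm)).bind fun x =>
    (bernoulli (I.duel a.fst a.snd) (I.duel_mem a.fst a.snd)).map fun y => ⟨a, x, y⟩

/-- Law of the first `t` rounds when policy `p` is run on instance `I`. -/
def law {K : ℕ} (I : Instance K) (p : Policy K) : (t : ℕ) → PMF (Fin t → Round K)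
  | 0 => PMF.pure Fin.elim0
  | t + 1 => (law I p t).bind fun h =>
      (p t h).bind fun a => (feedback I a).map fun r => (Fin.snoc h r : Fin (t + 1) → Round K)

/-- Expectation of a function of the first `t` rounds when policy `p` is run on `I`. -/
def expect {K : ℕ} (I : Instance K) (p : Policy K) (t : ℕ) (f : (Fin t → Round K) → ℝ) : ℝ :=
  ∑ h, (law I p t h).toReal * f h

/-- Number of rounds in which arm `k` is picked for reward feedback. -/
def rewardCount {K : ℕ} (k : Fin K) {t : ℕ} (h : Fin t → Round K) : ℕ :=
  (Finset.univ.filter fun s => (h s).action.arm = k).card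

/-- Number of rounds in which the pair `(k, l)` or the pair `(l, k)` is picked for a duel. -/
def duelCount {K : ℕ} (k l : Fin K) {t : ℕ} (h : Fin t → Round K) : ℕ :=
  (Finset.univ.filter fun s =>
    ((h s).action.fst = k ∧ (h s).action.snd = l) ∨
      ((h s).action.fst = l ∧ (h s).action.snd = k)).card

/-- The algorithm is consistent: on every instance and for every suboptimal arm, the expected
numbers of reward pulls and of duels with any other arm are `o(T ^ γ)` for all `γ > 0`. -/
def Consistent {K : ℕ} [NeZero K] (A : Algorithm K) : Prop :=
  ∀ I : Instance K, ∀ k, k ≠ I.opt → ∀ γ : ℝ, 0 < γ →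
    (fun T : ℕ => expect I (A T) T fun h => (rewardCount k h : ℝ)) =o[atTop]
      (fun T : ℕ => (T : ℝ) ^ γ) ∧
    ∀ l, l ≠ k →
      (fun T : ℕ => expect I (A T) T fun h => (duelCount k l h : ℝ)) =o[atTop]
        (fun T : ℕ => (T : ℝ) ^ γ)

/-- The reward-based regret. -/
def rewardRegret {K : ℕ} [NeZero K] (I : Instance K) {t : ℕ} (h : Fin t → Round K) : ℝ :=
  ∑ s, I.rewardGap (h s).action.arm

/-- The dueling-based regret. -/
def duelRegret {K : ℕ} [NeZero K] (I : Instance K) {t : ℕ} (h : Fin t → Round K) : ℝ :=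
  ∑ s, (I.duelGap (h s).action.fst + I.duelGap (h s).action.snd) / 2

/-- The aggregated regret with weight `α`. -/
def regret {K : ℕ} [NeZero K] (I : Instance K) (α : ℝ) {t : ℕ} (h : Fin t → Round K) : ℝ :=
  α * rewardRegret I h + (1 - α) * duelRegret I h

end

end DRMAB

/-! The proof is a change-of-measure argument, run once for each suboptimal arm `k`, followed by an
action-by-action comparison of information with regret.

Raise `k` slightly above the optimal arm, in reward mean and in its duels against better arms. In
this alternative `J` the old optimal arm is suboptimal, so a consistent algorithm pulls it o(√T)
times in expectation, whereas on `I` it is pulled at least T/2 times for large T. The variational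
inequality `expect_add_one_le`, applied to a multiple of that pull count, turns this discrepancy
into a divergence of order log T between the two laws (`eventually_log_le_expect_feedbackKL`). The
divergence is a sum over rounds, and only reward pulls of `k` and duels of `k` with better arms
contribute; hence the information collected about `k` is of order log T
(`eventually_log_le_expect_explorationCost`).

Information has a price. By the χ² bound a reward pull of `k` yields at most (Δᴿ)²/η² at cost αΔᴿ.
Since the optimal arm is the most effective competitor, a duel of `k` with `l` yields at most
4Δᴰₖ(Δᴰₖ+Δᴰₗ) at cost (1-α)(Δᴰₖ+Δᴰₗ)/2. Either way the regret per unit of information is at least a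
constant times `armRate` (`armRate_mul_explorationCost_le`). A duel is charged only to its worse
arm, so these costs can be summed over `k` without exceeding the regret (`sum_explorationCost_le`).
-/

namespace DRMAB

/-! ### Expectations under distributions on finite types -/

/-- The expectation of a real function under a distribution on a finite type. -/
noncomputable def pmfExp {α : Type*} [Fintype α] (p : PMF α) (g : α → ℝ) : ℝ :=
  ∑ x, (p x).toReal * g x

section pmfExp

variable {α β : Type*} [Fintype α] [Fintype β]

theorem pmfExp_add (p : PMF α) (f g : α → ℝ) :
    pmfExp p (fun x => f x + g x) = pmfExp p f + pmfExp p g := by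
  simp [pmfExp, mul_add, Finset.sum_add_distrib]

theorem pmfExp_const_mul (p : PMF α) (c : ℝ) (f : α → ℝ) :
    pmfExp p (fun x => c * f x) = c * pmfExp p f := by
  simp only [pmfExp, Finset.mul_sum]
  exact Finset.sum_congr rfl fun x _ => by ring

theorem pmfExp_sum {ι : Type*} (s : Finset ι) (p : PMF α) (f : ι → α → ℝ) :
    pmfExp p (fun x => ∑ i ∈ s, f i x) = ∑ i ∈ s, pmfExp p (f i) := by
  simp only [pmfExp, Finset.mul_sum]
  exact Finset.sum_comm

theorem pmfExp_mono (p : PMF α) {f g : α → ℝ} (h : ∀ x, f x ≤ g x) :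
    pmfExp p f ≤ pmfExp p g :=
  Finset.sum_le_sum fun x _ => mul_le_mul_of_nonneg_left (h x) ENNReal.toReal_nonneg

theorem pmfExp_const (p : PMF α) (c : ℝ) : pmfExp p (fun _ => c) = c := by
  have h : ∑ x, (p x).toReal = 1 := by
    rw [← ENNReal.toReal_sum fun x _ => p.apply_ne_top x, ← tsum_fintype (L := .unconditional α),
      p.tsum_coe, ENNReal.toReal_one]
  rw [pmfExp, ← Finset.sum_mul, h, one_mul]

theorem pmfExp_pure (a : α) (g : α → ℝ) : pmfExp (PMF.pure a) g = g a := by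
  classical
  rw [pmfExp, Finset.sum_eq_single a] <;> simp +contextual [PMF.pure_apply]

theorem pmfExp_bind (p : PMF α) (f : α → PMF β) (g : β → ℝ) :
    pmfExp (p.bind f) g = pmfExp p fun a => pmfExp (f a) g := by
  have h : ∀ b, (p.bind f b).toReal = ∑ a, (p a).toReal * (f a b).toReal := fun b => by
    rw [PMF.bind_apply, tsum_fintype, ENNReal.toReal_sum]
    · simp
    · exact fun a _ => ENNReal.mul_ne_top (p.apply_ne_top a) ((f a).apply_ne_top b)
  simp only [pmfExp, h, Finset.sum_mul, Finset.mul_sum]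
  rw [Finset.sum_comm]
  exact Finset.sum_congr rfl fun _ _ => Finset.sum_congr rfl fun _ _ => by ring

theorem pmfExp_map (p : PMF α) (f : α → β) (g : β → ℝ) :
    pmfExp (p.map f) g = pmfExp p fun a => g (f a) := by
  rw [PMF.map, pmfExp_bind]
  simp [pmfExp_pure]

end pmfExp

/-! ### Bernoulli distributions and their divergence -/

/-- The probability of the outcome `b` under the Bernoulli distribution with mean `p`. -/
noncomputable def bernoulliWeight (p : ℝ) (b : Bool) : ℝ :=
  if b then p else 1 - p

theorem bernoulliWeight_pos {p : ℝ} (hp : p ∈ Set.Ioo (0 : ℝ) 1) (b : Bool) :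
    0 < bernoulliWeight p b := by
  cases b <;> simp [bernoulliWeight, hp.1, hp.2]

theorem pmfExp_bernoulli (p : ℝ) (hp : p ∈ Set.Ioo (0 : ℝ) 1) (g : Bool → ℝ) :
    pmfExp (bernoulli p hp) g = p * g true + (1 - p) * g false := by
  simp [pmfExp, bernoulli, ENNReal.toReal_ofReal, hp.1.le, hp.2.le]

theorem pmfExp_bernoulli_log (p q : ℝ) (hp : p ∈ Set.Ioo (0 : ℝ) 1) :
    pmfExp (bernoulli p hp)
      (fun b => Real.log (bernoulliWeight p b / bernoulliWeight q b)) = kl p q := by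
  simp [pmfExp_bernoulli, bernoulliWeight, kl]

theorem pmfExp_bernoulli_ratio {p q : ℝ} (hp : p ∈ Set.Ioo (0 : ℝ) 1) (hq : q ∈ Set.Ioo (0 : ℝ) 1)
    (g : Bool → ℝ) :
    pmfExp (bernoulli p hp) (fun b => bernoulliWeight q b / bernoulliWeight p b * g b) =
      pmfExp (bernoulli q hq) g := by
  have h1 := hp.1.ne'
  have h2 : 1 - p ≠ 0 := by linarith [hp.2]
  simp only [pmfExp_bernoulli, bernoulliWeight, if_true, Bool.false_eq_true, if_false]
  field_simp

theorem kl_self (p : ℝ) : kl p p = 0 := by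
  by_cases h : p = 0 <;> by_cases h' : 1 - p = 0 <;> simp [kl, h, h']

theorem kl_one_sub (p q : ℝ) : kl (1 - p) (1 - q) = kl p q := by
  simp only [kl, sub_sub_cancel]
  ring

theorem kl_pos {p q : ℝ} (hp : p ∈ Set.Ioo (0 : ℝ) 1) (hq : q ∈ Set.Ioo (0 : ℝ) 1) (h : p ≠ q) :
    0 < kl p q := by
  have hp' : 0 < 1 - p := by linarith [hp.2]
  have hq' : 0 < 1 - q := by linarith [hq.2]
  have h1 : Real.log (q / p) < q / p - 1 :=
    Real.log_lt_sub_one_of_pos (div_pos hq.1 hp.1) fun e =>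
      h ((div_eq_one_iff_eq hp.1.ne').1 e).symm
  have h2 : Real.log ((1 - q) / (1 - p)) ≤ (1 - q) / (1 - p) - 1 :=
    Real.log_le_sub_one_of_pos (div_pos hq' hp')
  have e1 : Real.log (p / q) = -Real.log (q / p) := by rw [← Real.log_inv, inv_div]
  have e2 : Real.log ((1 - p) / (1 - q)) = -Real.log ((1 - q) / (1 - p)) := by
    rw [← Real.log_inv, inv_div]
  have h3 := mul_lt_mul_of_pos_left h1 hp.1
  have h4 := mul_le_mul_of_nonneg_left h2 hp'.le
  have e3 : p * (q / p - 1) = q - p := by field_simp [hp.1.ne']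
  have e4 : (1 - p) * ((1 - q) / (1 - p) - 1) = p - q := by field_simp [hp'.ne']; ring
  rw [kl, e1, e2]
  linarith

/-- Bounding both logarithms by `log x ≤ x - 1` leaves exactly the χ² divergence. -/
theorem kl_le_sq_div {p q : ℝ} (hp : p ∈ Set.Ioo (0 : ℝ) 1) (hq : q ∈ Set.Ioo (0 : ℝ) 1) :
    kl p q ≤ (p - q) ^ 2 / (q * (1 - q)) := by
  have hp' : 0 < 1 - p := by linarith [hp.2]
  have hq' : 0 < 1 - q := by linarith [hq.2]
  have h1 := mul_le_mul_of_nonneg_left (Real.log_le_sub_one_of_pos (div_pos hp.1 hq.1)) hp.1.le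
  have h2 := mul_le_mul_of_nonneg_left (Real.log_le_sub_one_of_pos (div_pos hp' hq')) hp'.le
  have e : p * (p / q - 1) + (1 - p) * ((1 - p) / (1 - q) - 1) = (p - q) ^ 2 / (q * (1 - q)) := by
    have := hq.1.ne'
    have := hq'.ne'
    field_simp
    ring
  rw [kl, ← e]
  exact add_le_add h1 h2

theorem continuousAt_kl {p q : ℝ} (hp : p ∈ Set.Ioo (0 : ℝ) 1) (hq : q ∈ Set.Ioo (0 : ℝ) 1) :
    ContinuousAt (kl p) q := by
  have hp' : 1 - p ≠ 0 := by linarith [hp.2]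
  have hq' : 1 - q ≠ 0 := by linarith [hq.2]
  have := hp.1.ne'
  have := hq.1.ne'
  unfold kl
  refine ContinuousAt.add (continuousAt_const.mul (ContinuousAt.log ?_ (by positivity)))
    (continuousAt_const.mul (ContinuousAt.log ?_ (by positivity)))
  · exact continuousAt_const.div continuousAt_id (by assumption)
  · exact continuousAt_const.div (continuousAt_const.sub continuousAt_id) hq'

/-! ### Change of measure between two instances -/

section divergence

variable {K : ℕ}

theorem expect_eq_pmfExp (I : Instance K) (p : Policy K) (t : ℕ) (f : (Fin t → Round K) → ℝ) :
    expect I p t f = pmfExp (law I p t) f := rfl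

theorem expect_succ (I : Instance K) (p : Policy K) (t : ℕ) (f : (Fin (t + 1) → Round K) → ℝ) :
    expect I p (t + 1) f = expect I p t fun h => pmfExp (p t h) fun a =>
      pmfExp (feedback I a) fun r => f (Fin.snoc h r) := by
  simp only [expect_eq_pmfExp, law, pmfExp_bind, pmfExp_map]

theorem pmfExp_feedback (I : Instance K) (a : Action K) (g : Round K → ℝ) :
    pmfExp (feedback I a) g =
      pmfExp (bernoulli (I.mean a.arm) (I.mean_mem a.arm)) fun x =>
        pmfExp (bernoulli (I.duel a.fst a.snd) (I.duel_mem a.fst a.snd)) fun y => g ⟨a, x, y⟩ := by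
  simp only [feedback, pmfExp_bind, pmfExp_map]

/-- The likelihood ratio of one round between `J` and `I`. -/
noncomputable def likelihoodRatio (I J : Instance K) (r : Round K) : ℝ :=
  bernoulliWeight (J.mean r.action.arm) r.reward / bernoulliWeight (I.mean r.action.arm) r.reward *
    (bernoulliWeight (J.duel r.action.fst r.action.snd) r.fstWins /
      bernoulliWeight (I.duel r.action.fst r.action.snd) r.fstWins)

/-- The Kullback--Leibler divergence between the feedback distributions of an action. -/
noncomputable def feedbackKL (I J : Instance K) (a : Action K) : ℝ :=
  kl (I.mean a.arm) (J.mean a.arm) + kl (I.duel a.fst a.snd) (J.duel a.fst a.snd)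

theorem likelihoodRatio_pos (I J : Instance K) (r : Round K) : 0 < likelihoodRatio I J r :=
  mul_pos (div_pos (bernoulliWeight_pos (J.mean_mem _) _) (bernoulliWeight_pos (I.mean_mem _) _))
    (div_pos (bernoulliWeight_pos (J.duel_mem _ _) _) (bernoulliWeight_pos (I.duel_mem _ _) _))

theorem pmfExp_feedback_likelihoodRatio (I J : Instance K) (a : Action K) (g : Round K → ℝ) :
    pmfExp (feedback I a) (fun r => likelihoodRatio I J r * g r) = pmfExp (feedback J a) g := by
  simp only [pmfExp_feedback, likelihoodRatio, mul_assoc, pmfExp_const_mul]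
  rw [← pmfExp_bernoulli_ratio (I.mean_mem a.arm) (J.mean_mem a.arm)]
  simp only [pmfExp_bernoulli_ratio (I.duel_mem _ _) (J.duel_mem _ _)]

/-- The two sides agree only on average over the feedback: the log-likelihood ratio splits into a
reward part and a duel part, each with a binary divergence as its mean. -/
theorem pmfExp_feedback_log (I J : Instance K) (a : Action K) :
    pmfExp (feedback I a) (fun r => -Real.log (likelihoodRatio I J r)) =
      pmfExp (feedback I a) fun r => feedbackKL I J r.action := by
  have h : ∀ r : Round K, -Real.log (likelihoodRatio I J r) =
      Real.log (bernoulliWeight (I.mean r.action.arm) r.reward /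
        bernoulliWeight (J.mean r.action.arm) r.reward) +
      Real.log (bernoulliWeight (I.duel r.action.fst r.action.snd) r.fstWins /
        bernoulliWeight (J.duel r.action.fst r.action.snd) r.fstWins) := fun r => by
    rw [likelihoodRatio, Real.log_mul, neg_add, ← Real.log_inv, ← Real.log_inv, inv_div, inv_div]
    · exact (div_pos (bernoulliWeight_pos (J.mean_mem _) _)
        (bernoulliWeight_pos (I.mean_mem _) _)).ne'
    · exact (div_pos (bernoulliWeight_pos (J.duel_mem _ _) _)
        (bernoulliWeight_pos (I.duel_mem _ _) _)).ne'
  simp only [h, pmfExp_feedback, pmfExp_add, pmfExp_const, pmfExp_bernoulli_log, feedbackKL]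

/-- The policy is the same on both instances, so its probabilities cancel and only feedback ratios
remain. All Bernoulli means lie strictly inside (0, 1), so no absolute continuity condition is
needed. -/
theorem expect_prod_likelihoodRatio (I J : Instance K) (p : Policy K) (t : ℕ)
    (g : (Fin t → Round K) → ℝ) :
    expect I p t (fun h => (∏ s, likelihoodRatio I J (h s)) * g h) = expect J p t g := by
  induction t with
  | zero => simp only [expect_eq_pmfExp, law, pmfExp_pure]; simp
  | succ t ih =>
    rw [expect_succ, expect_succ, ← ih]
    simp only [Fin.prod_univ_castSucc, Fin.snoc_castSucc, Fin.snoc_last, mul_assoc,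
      pmfExp_const_mul, pmfExp_feedback_likelihoodRatio]

/-- Conditioning on the action round by round. With `pmfExp_feedback_log` this gives the
decomposition of the divergence of the laws into per-round divergences. -/
theorem expect_sum_congr (I : Instance K) (p : Policy K) {u v : Round K → ℝ}
    (huv : ∀ a, pmfExp (feedback I a) u = pmfExp (feedback I a) v) (t : ℕ) :
    expect I p t (fun h => ∑ s, u (h s)) = expect I p t fun h => ∑ s, v (h s) := by
  induction t with
  | zero => simp
  | succ t ih =>
    rw [expect_succ, expect_succ]
    simp only [Fin.sum_univ_castSucc, Fin.snoc_castSucc, Fin.snoc_last, pmfExp_add, pmfExp_const,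
      huv]
    simp only [expect_eq_pmfExp, pmfExp_add] at ih ⊢
    rw [ih]

/-- A variational lower bound for the divergence between the laws on two instances. -/
theorem expect_add_one_le (I J : Instance K) (p : Policy K) (t : ℕ) (f : (Fin t → Round K) → ℝ) :
    expect I p t f + 1 ≤ expect I p t (fun h => ∑ s, feedbackKL I J (h s).action) +
      expect J p t fun h => Real.exp (f h) := by
  rw [← expect_sum_congr I p (pmfExp_feedback_log I J), ← expect_prod_likelihoodRatio I J]
  simp only [expect_eq_pmfExp]
  rw [← pmfExp_add, ← pmfExp_const (law I p t) 1, ← pmfExp_add]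
  refine pmfExp_mono _ fun h => ?_
  have hL : ∏ s, likelihoodRatio I J (h s) =
      Real.exp (-∑ s, -Real.log (likelihoodRatio I J (h s))) := by
    rw [Finset.sum_neg_distrib, neg_neg, Real.exp_sum]
    exact Finset.prod_congr rfl fun s _ => (Real.exp_log (likelihoodRatio_pos I J _)).symm
  -- With L the likelihood ratio, this is `1 + x ≤ exp x` at x = log L + f; the expectation under
  -- `I` of L · exp f is that of exp f under `J`.
  have := Real.add_one_le_exp (-∑ s, -Real.log (likelihoodRatio I J (h s)) + f h)
  rw [hL, ← Real.exp_add]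
  linarith

end divergence

end DRMAB

namespace DRMAB

/-! ### Exploration cost and its comparison with regret -/

section exploration

variable {K : ℕ}

theorem sum_rewardCount {t : ℕ} (h : Fin t → Round K) : ∑ k, rewardCount k h = t := by
  simpa [rewardCount] using
    (Finset.card_eq_sum_card_fiberwise (s := (Finset.univ : Finset (Fin t)))
      (f := fun s => (h s).action.arm) (t := Finset.univ) (by simp)).symm

theorem rewardCount_le {t : ℕ} (k : Fin K) (h : Fin t → Round K) : rewardCount k h ≤ t :=
  (Finset.card_filter_le _ _).trans (by simp)

/-- The cost of an action for arm `k`: `x` for a reward pull of `k`, and `y l` for a duel of `k`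
with a better arm `l`. -/
noncomputable def explorationCost (I : Instance K) (k : Fin K) (x : ℝ) (y : Fin K → ℝ)
    (a : Action K) : ℝ :=
  (if a.arm = k then x else 0) + ∑ l with I.mean k < I.mean l,
    if (a.fst = k ∧ a.snd = l) ∨ (a.fst = l ∧ a.snd = k) then y l else 0

theorem explorationCost_mono (I : Instance K) (k : Fin K) {x x' : ℝ} {y y' : Fin K → ℝ}
    (hx : x ≤ x') (hy : ∀ l, I.mean k < I.mean l → y l ≤ y' l) (a : Action K) :
    explorationCost I k x y a ≤ explorationCost I k x' y' a := by
  refine add_le_add (by split_ifs <;> simp [hx]) (Finset.sum_le_sum fun l hl => ?_)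
  have := hy l (Finset.mem_filter.1 hl).2
  split_ifs <;> simp [this]

theorem explorationCost_const_mul (I : Instance K) (k : Fin K) (c x : ℝ) (y : Fin K → ℝ)
    (a : Action K) :
    explorationCost I k (c * x) (fun l => c * y l) a = c * explorationCost I k x y a := by
  simp [explorationCost, mul_add, Finset.mul_sum, mul_ite]

theorem Instance.duel_self (I : Instance K) (k : Fin K) : I.duel k k = 1 / 2 := by
  linarith [I.duel_symm k k]

variable [NeZero K]

theorem Instance.eq_opt_of_forall_le (I : Instance K) {a : Fin K}
    (h : ∀ k, I.mean k ≤ I.mean a) : a = I.opt :=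
  I.mean_injective (le_antisymm (I.mean_le_opt a) (h I.opt))

theorem Instance.mean_lt_opt (I : Instance K) {k : Fin K} (hk : k ≠ I.opt) :
    I.mean k < I.mean I.opt :=
  lt_of_le_of_ne (I.mean_le_opt k) fun h => hk (I.mean_injective h)

theorem Instance.duelGap_opt (I : Instance K) : I.duelGap I.opt = 0 := by
  simp [Instance.duelGap, I.duel_self]

theorem Instance.duelGap_pos (I : Instance K) {k : Fin K} (hk : k ≠ I.opt) : 0 < I.duelGap k :=
  sub_pos.2 (I.duel_gt _ _ (I.mean_lt_opt hk))

theorem Instance.duelGap_nonneg (I : Instance K) (k : Fin K) : 0 ≤ I.duelGap k := by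
  by_cases hk : k = I.opt
  · rw [hk, I.duelGap_opt]
  · exact (I.duelGap_pos hk).le

theorem Instance.rewardGap_opt (I : Instance K) : I.rewardGap I.opt = 0 := sub_self _

theorem Instance.rewardGap_pos (I : Instance K) {k : Fin K} (hk : k ≠ I.opt) :
    0 < I.rewardGap k :=
  sub_pos.2 (I.mean_lt_opt hk)

/-- Charging each duel of two different arms to the worse one never exceeds its regret. -/
theorem sum_explorationCost_le (I : Instance K) {α : ℝ} (hα : α ≤ 1) (a : Action K) :
    ∑ k ∈ Finset.univ.erase I.opt, explorationCost I k (α * I.rewardGap k)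
        (fun l => (1 - α) * ((I.duelGap k + I.duelGap l) / 2)) a ≤
      α * I.rewardGap a.arm + (1 - α) * ((I.duelGap a.fst + I.duelGap a.snd) / 2) := by
  have hα' : 0 ≤ 1 - α := by linarith
  have hnn : ∀ k l, 0 ≤ (1 - α) * ((I.duelGap k + I.duelGap l) / 2) := fun k l =>
    mul_nonneg hα' (by linarith [I.duelGap_nonneg k, I.duelGap_nonneg l])
  simp only [explorationCost, Finset.sum_add_distrib]
  refine add_le_add ?_ ?_
  · rw [Finset.sum_ite_eq]
    split_ifs with h
    · exact le_rfl
    · simp only [Finset.mem_erase, Finset.mem_univ, and_true, not_not] at h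
      simp [h, I.rewardGap_opt]
  · have key : ∀ b c : Fin K, I.mean b ≤ I.mean c →
        ((a.fst = b ∧ a.snd = c) ∨ (a.fst = c ∧ a.snd = b)) →
        ∑ k ∈ Finset.univ.erase I.opt, ∑ l with I.mean k < I.mean l,
          (if (a.fst = k ∧ a.snd = l) ∨ (a.fst = l ∧ a.snd = k) then
            (1 - α) * ((I.duelGap k + I.duelGap l) / 2) else 0) ≤
        (1 - α) * ((I.duelGap b + I.duelGap c) / 2) := by
      intro b c hbc habc
      calc _ ≤ ∑ k ∈ Finset.univ.erase I.opt, ∑ l with I.mean k < I.mean l,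
            (if k = b then if l = c then (1 - α) * ((I.duelGap b + I.duelGap c) / 2) else 0
              else 0) := by
            refine Finset.sum_le_sum fun k _ => Finset.sum_le_sum fun l hl => ?_
            have hkl := (Finset.mem_filter.1 hl).2
            -- If {k, l} and {b, c} are both the duelled pair, the order of the means forces k = b
            -- and l = c; the mismatched cases are contradictory.
            split_ifs with h1 h2 h3 h3 <;> try first | exact hnn _ _ | exact le_rfl
            · rw [h2, h3]
            all_goals
              exfalso
              rcases h1 with ⟨e1, e2⟩ | ⟨e1, e2⟩ <;> rcases habc with ⟨e3, e4⟩ | ⟨e3, e4⟩ <;>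
                simp_all <;> linarith
        _ ≤ _ := by
            refine (Finset.sum_le_univ_sum_of_nonneg fun k => Finset.sum_nonneg fun l _ => ?_).trans
              ((Finset.sum_le_sum fun k _ => Finset.sum_le_univ_sum_of_nonneg fun l => ?_).trans ?_)
            · split_ifs <;> first | exact hnn _ _ | exact le_rfl
            · split_ifs <;> first | exact hnn _ _ | exact le_rfl
            · simp
    rcases le_total (I.mean a.fst) (I.mean a.snd) with h | h
    · exact key _ _ h (Or.inl ⟨rfl, rfl⟩)
    · rw [add_comm (I.duelGap a.fst)]
      exact key _ _ h (Or.inr ⟨rfl, rfl⟩)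

/-! ### The alternative instance -/

/-- The instance in which arm `k` is made optimal by raising its mean above all others, and its
winning probabilities against the better arms above `1 / 2`. -/
noncomputable def Instance.raise (I : Instance K) (k : Fin K) (ε : ℝ) (hε : 0 < ε)
    (hε₁ : ε < 1 / 2) (hε₂ : I.mean I.opt + ε < 1) : Instance K where
  mean := Function.update I.mean k (I.mean I.opt + ε)
  -- Duels of `k` with worse arms are left alone: they already favour `k`, so they need carry no
  -- information.
  duel a b :=
    if a = k ∧ I.mean k < I.mean b then 1 / 2 + ε
    else if b = k ∧ I.mean k < I.mean a then 1 / 2 - ε else I.duel a b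
  mean_mem a := by
    by_cases h : a = k
    · subst h
      simpa using ⟨by linarith [(I.mean_mem I.opt).1], hε₂⟩
    · simpa [h] using I.mean_mem a
  mean_injective a b hab := by
    have ha := I.mean_le_opt a
    have hb := I.mean_le_opt b
    by_cases h : a = k <;> by_cases h' : b = k <;> simp [h, h'] at hab
    · rw [h, h']
    · linarith
    · linarith
    · exact I.mean_injective hab
  duel_mem a b := by
    have := I.duel_mem a b
    split_ifs
    · exact ⟨by linarith, by linarith⟩
    · exact ⟨by linarith, by linarith⟩
    · exact this
  duel_symm a b := by
    have := I.duel_symm a b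
    split_ifs with h1 h2 <;> try linarith
    obtain ⟨rfl, h1⟩ := h1
    obtain ⟨rfl, h2⟩ := h2
    exact absurd h2 (lt_irrefl _)
  duel_gt a b hab := by
    have ha := I.mean_le_opt a
    by_cases hb : b = k
    · subst hb
      by_cases ha' : a = b
      · subst ha'
        exact absurd hab (lt_irrefl _)
      · simp [ha'] at hab
        linarith
    · by_cases ha' : a = k
      · subst ha'
        by_cases h : I.mean a < I.mean b
        · simp [h, hε]
        · have := I.duel_gt a b
            (lt_of_le_of_ne (not_lt.1 h) fun e => hb (I.mean_injective e))
          simpa [h, hb] using this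
      · simp only [ne_eq, hb, ha', not_false_eq_true, Function.update_of_ne] at hab
        simpa [ha', hb] using I.duel_gt a b hab

theorem Instance.opt_raise (I : Instance K) (k : Fin K) (ε : ℝ) (hε : 0 < ε)
    (hε₁ : ε < 1 / 2) (hε₂ : I.mean I.opt + ε < 1) : (I.raise k ε hε hε₁ hε₂).opt = k := by
  refine ((I.raise k ε hε hε₁ hε₂).eq_opt_of_forall_le fun a => ?_).symm
  have ha := I.mean_le_opt a
  by_cases h : a = k
  · rw [h]
  · simp [Instance.raise, h]
    linarith

/-- Only feedback involving `k` can differ. A changed duel matches one term of the cost sum, the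
other terms being nonnegative; when `k` is second in the pair, `kl_one_sub` exchanges the roles. -/
theorem feedbackKL_raise_le (I : Instance K) (k : Fin K) (ε : ℝ) (hε : 0 < ε)
    (hε₁ : ε < 1 / 2) (hε₂ : I.mean I.opt + ε < 1) (a : Action K) :
    feedbackKL I (I.raise k ε hε hε₁ hε₂) a ≤
      explorationCost I k (kl (I.mean k) (I.mean I.opt + ε))
        (fun l => kl (I.duel k l) (1 / 2 + ε)) a := by
  have hnn : ∀ l, I.mean k < I.mean l → 0 ≤ kl (I.duel k l) (1 / 2 + ε) := fun l hl =>
    (kl_pos (I.duel_mem k l) ⟨by linarith, by linarith⟩ (by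
      linarith [I.duel_gt l k hl, I.duel_symm k l] :
        I.duel k l < 1 / 2 + ε).ne).le
  have hnn' : ∀ l ∈ Finset.univ.filter fun l => I.mean k < I.mean l,
      0 ≤ if (a.fst = k ∧ a.snd = l) ∨ (a.fst = l ∧ a.snd = k) then
        kl (I.duel k l) (1 / 2 + ε) else 0 := fun l hl => by
    split_ifs
    · exact hnn l (Finset.mem_filter.1 hl).2
    · exact le_rfl
  refine add_le_add ?_ ?_
  · by_cases h : a.arm = k <;> simp [h, Instance.raise, kl_self]
  · by_cases h1 : a.fst = k ∧ I.mean k < I.mean a.snd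
    · refine le_trans (le_of_eq ?_) (Finset.single_le_sum hnn'
        (Finset.mem_filter.2 ⟨Finset.mem_univ a.snd, h1.2⟩))
      simp [Instance.raise, h1]
    · by_cases h2 : a.snd = k ∧ I.mean k < I.mean a.fst
      · refine le_trans (le_of_eq ?_) (Finset.single_le_sum hnn'
          (Finset.mem_filter.2 ⟨Finset.mem_univ a.fst, h2.2⟩))
        simp only [Instance.raise, if_neg h1, if_pos h2]
        rw [if_pos (Or.inr ⟨trivial, h2.1⟩), ← kl_one_sub, ← h2.1, ← I.duel_symm a.snd a.fst]
        congr 1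
        ring
      · simp only [Instance.raise, h1, h2, if_false, kl_self]
        exact Finset.sum_nonneg hnn'

/-! ### Logarithmic lower bounds on information -/

/-- The divergence between two instances with different optimal arms grows at least
logarithmically under a consistent algorithm. -/
theorem eventually_log_le_expect_feedbackKL {A : Algorithm K} (hA : Consistent A)
    {I J : Instance K} (hIJ : I.opt ≠ J.opt) :
    ∀ᶠ T : ℕ in atTop, Real.log T / 8 ≤
      expect I (A T) T fun h => ∑ s, feedbackKL I J (h s).action := by
  have hK : 0 < (K : ℝ) := Nat.cast_pos.2 (NeZero.pos K)
  have h1 := (hA J I.opt hIJ (1 / 2) (by norm_num)).1.bound (c := 1) one_pos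
  -- The share T/(2K) per suboptimal arm leaves at least T/2 expected pulls for the optimal arm.
  have h2 : ∀ᶠ T : ℕ in atTop, ∀ k, k ≠ I.opt →
      expect I (A T) T (fun h => (rewardCount k h : ℝ)) ≤ (2 * K : ℝ)⁻¹ * T := by
    refine eventually_all.2 fun k => ?_
    by_cases hk : k = I.opt
    · simp [hk]
    · filter_upwards [(hA I k hk 1 one_pos).1.bound (c := (2 * K : ℝ)⁻¹) (by positivity)]
        with T hT _
      simpa using (Real.le_norm_self _).trans hT
  have h3 : ∀ᶠ T : ℕ in atTop, 8 ≤ Real.log T :=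
    (Real.tendsto_log_atTop.comp tendsto_natCast_atTop_atTop).eventually_ge_atTop 8
  filter_upwards [h1, h2, h3, eventually_gt_atTop 0] with T h1 h2 h3 hT
  have hT' : (0 : ℝ) < T := Nat.cast_pos.2 hT
  have hsqrt : Real.exp (Real.log T / 2) = (T : ℝ) ^ (1 / 2 : ℝ) := by
    rw [Real.rpow_def_of_pos hT']
    ring_nf
  have hsq : (T : ℝ) ^ (1 / 2 : ℝ) * (T : ℝ) ^ (1 / 2 : ℝ) = T := by
    rw [← Real.rpow_add hT']
    norm_num
  have hpos : 0 < (T : ℝ) ^ (1 / 2 : ℝ) := by positivity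
  set u := (T : ℝ) ^ (1 / 2 : ℝ)
  rw [one_mul, Real.norm_of_nonneg hpos.le] at h1
  have h1 := (Real.le_norm_self _).trans h1
  have hJ : expect J (A T) T
      (fun h => Real.exp (Real.log T / 2 / T * (rewardCount I.opt h : ℝ))) ≤ 2 := by
    -- The chord of exp between 0 and (log T)/2 makes the exponential moment linear in the count.
    -- The slope √T/T and the expected count at most √T under `J` multiply to at most 1.
    have : ∀ h : Fin T → Round K, Real.exp (Real.log T / 2 / T * (rewardCount I.opt h : ℝ)) ≤
        1 + u / T * (rewardCount I.opt h : ℝ) := fun h => by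
      have hle : (rewardCount I.opt h : ℝ) / T ≤ 1 :=
        (div_le_one hT').2 (Nat.cast_le.2 (rewardCount_le _ h))
      have hnn : 0 ≤ (rewardCount I.opt h : ℝ) / T := by positivity
      have := convexOn_exp.2 (Set.mem_univ (0 : ℝ)) (Set.mem_univ (Real.log T / 2))
        (sub_nonneg.2 hle) hnn (sub_add_cancel _ _)
      simp only [smul_eq_mul, mul_zero, zero_add, Real.exp_zero, mul_one, hsqrt] at this
      calc _ = Real.exp ((rewardCount I.opt h : ℝ) / T * (Real.log T / 2)) := by ring_nf
        _ ≤ _ := this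
        _ ≤ 1 + (rewardCount I.opt h : ℝ) / T * u := by linarith
        _ = _ := by ring
    refine (pmfExp_mono _ this).trans ?_
    rw [pmfExp_add, pmfExp_const, pmfExp_const_mul]
    have := mul_le_mul_of_nonneg_left h1 (by positivity : 0 ≤ u / T)
    rw [div_mul_eq_mul_div u T u, hsq, div_self hT'.ne'] at this
    rw [expect_eq_pmfExp] at this
    linarith
  have hI : (T : ℝ) / 2 ≤ expect I (A T) T fun h => (rewardCount I.opt h : ℝ) := by
    have hsum : ∑ k, expect I (A T) T (fun h => (rewardCount k h : ℝ)) = T := by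
      simp only [expect_eq_pmfExp]
      rw [← pmfExp_sum]
      simp only [← Nat.cast_sum, sum_rewardCount, pmfExp_const]
    rw [← Finset.add_sum_erase _ _ (Finset.mem_univ I.opt)] at hsum
    have hle : ∑ k ∈ Finset.univ.erase I.opt, expect I (A T) T (fun h => (rewardCount k h : ℝ)) ≤
        T / 2 := by
      calc _ ≤ ∑ k ∈ Finset.univ.erase I.opt, (2 * K : ℝ)⁻¹ * T :=
            Finset.sum_le_sum fun k hk => h2 k (Finset.ne_of_mem_erase hk)
        _ ≤ ∑ _k : Fin K, (2 * K : ℝ)⁻¹ * T :=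
            Finset.sum_le_univ_sum_of_nonneg fun _ => by positivity
        _ = T / 2 := by
            simp only [Finset.sum_const, Finset.card_univ, Fintype.card_fin, nsmul_eq_mul]
            field_simp
    linarith
  have main := expect_add_one_le I J (A T) T
    fun h => Real.log T / 2 / T * (rewardCount I.opt h : ℝ)
  simp only [expect_eq_pmfExp, pmfExp_const_mul] at main hJ hI ⊢
  have h4 := mul_le_mul_of_nonneg_left hI (by positivity : 0 ≤ Real.log T / 2 / T)
  have h5 : Real.log T / 2 / T * (T / 2) = Real.log T / 4 := by field_simp; norm_num
  -- The divergence is at least (log T)/4 + 1 - 2, which is at least (log T)/8 once log T ≥ 8.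
  linarith

/-- By continuity of `kl`, some fixed ε, independent of T, at most doubles all the relevant
divergences; this removes ε at the price of halving the constant 1/8. -/
theorem eventually_log_le_expect_explorationCost {A : Algorithm K} (hA : Consistent A)
    (I : Instance K) {k : Fin K} (hk : k ≠ I.opt) :
    ∀ᶠ T : ℕ in atTop, Real.log T / 16 ≤
      expect I (A T) T fun h => ∑ s, explorationCost I k (kl (I.mean k) (I.mean I.opt))
        (fun l => kl (I.duel k l) (1 / 2)) (h s).action := by
  have hlim : ∀ {p q : ℝ}, p ∈ Set.Ioo (0 : ℝ) 1 → q ∈ Set.Ioo (0 : ℝ) 1 → p ≠ q →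
      ∀ᶠ ε in nhdsWithin (0 : ℝ) (Set.Ioi 0), kl p (q + ε) ≤ 2 * kl p q := by
    intro p q hp hq h
    have hc : Tendsto (fun ε : ℝ => kl p (q + ε)) (nhds 0) (nhds (kl p q)) := by
      have h0 : Tendsto (fun ε : ℝ => q + ε) (nhds 0) (nhds q) := by
        simpa using (continuous_const_add q).tendsto (0 : ℝ)
      exact (continuousAt_kl hp hq).tendsto.comp h0
    refine (hc.mono_left nhdsWithin_le_nhds).eventually_le_const ?_
    linarith [kl_pos hp hq h]
  have hd : ∀ᶠ ε in nhdsWithin (0 : ℝ) (Set.Ioi 0), ∀ l, I.mean k < I.mean l →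
      kl (I.duel k l) (1 / 2 + ε) ≤ 2 * kl (I.duel k l) (1 / 2) := by
    refine eventually_all.2 fun l => ?_
    by_cases hl : I.mean k < I.mean l
    · filter_upwards [hlim (I.duel_mem k l) (q := 1 / 2) (by norm_num)
        (by linarith [I.duel_gt l k hl, I.duel_symm k l] : I.duel k l < 1 / 2).ne] with ε h _ using h
    · simp [hl]
  have hlt := (I.mean_mem I.opt).2
  obtain ⟨ε, ⟨hm, hd, hs⟩, hε⟩ := ((hlim (I.mean_mem k) (I.mean_mem I.opt)
    (I.mean_lt_opt hk).ne).and (hd.and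
      ((eventually_lt_nhds (lt_min (by norm_num : (0 : ℝ) < 1 / 2) (sub_pos.2 hlt))).filter_mono
        nhdsWithin_le_nhds)) |>.and self_mem_nhdsWithin).exists
  have hε₁ : ε < 1 / 2 := hs.trans_le (min_le_left _ _)
  have hε₂ : I.mean I.opt + ε < 1 := by linarith [hs.trans_le (min_le_right _ _)]
  filter_upwards [eventually_log_le_expect_feedbackKL hA (I := I) (J := I.raise k ε hε hε₁ hε₂)
    (by rw [I.opt_raise]; exact hk.symm)] with T hT
  have hle : expect I (A T) T (fun h => ∑ s, feedbackKL I (I.raise k ε hε hε₁ hε₂) (h s).action) ≤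
      expect I (A T) T fun h => 2 * ∑ s, explorationCost I k (kl (I.mean k) (I.mean I.opt))
        (fun l => kl (I.duel k l) (1 / 2)) (h s).action := by
    refine pmfExp_mono _ fun h => ?_
    rw [Finset.mul_sum]
    refine Finset.sum_le_sum fun s _ => ?_
    rw [← explorationCost_const_mul]
    exact (feedbackKL_raise_le I k ε hε hε₁ hε₂ _).trans (explorationCost_mono I k hm hd _)
  simp only [expect_eq_pmfExp, pmfExp_const_mul] at hle hT ⊢
  linarith

/-! ### From information to regret -/

/-- The contribution of arm `k` to the lower bound, up to a constant. -/
noncomputable def armRate (I : Instance K) (α : ℝ) (k : Fin K) : ℝ :=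
  min (α / I.rewardGap k) ((1 - α) / I.duelGap k)

theorem armRate_nonneg (I : Instance K) {α : ℝ} (hα₀ : 0 ≤ α) (hα₁ : α ≤ 1) {k : Fin K}
    (hk : k ≠ I.opt) : 0 ≤ armRate I α k :=
  le_min (div_nonneg hα₀ (I.rewardGap_pos hk).le)
    (div_nonneg (by linarith) (I.duelGap_pos hk).le)

theorem kl_duel_opt_le (I : Instance K) (k : Fin K) :
    kl (I.duel k I.opt) (1 / 2) ≤ 4 * I.duelGap k ^ 2 := by
  refine (kl_le_sq_div (I.duel_mem k I.opt) (by norm_num)).trans (le_of_eq ?_)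
  rw [I.duel_symm k I.opt, Instance.duelGap]
  ring

theorem kl_mean_opt_le (I : Instance K) {η : ℝ} (hη : 0 < η) (h₁ : η ≤ I.mean I.opt)
    (h₂ : I.mean I.opt ≤ 1 - η) (k : Fin K) :
    η ^ 2 * kl (I.mean k) (I.mean I.opt) ≤ I.rewardGap k ^ 2 := by
  have h := kl_le_sq_div (I.mean_mem k) (I.mean_mem I.opt)
  have hη2 : η ^ 2 ≤ I.mean I.opt * (1 - I.mean I.opt) := by
    rw [sq]
    exact mul_le_mul h₁ (by linarith) hη.le (hη.le.trans h₁)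
  have hpos : 0 < η ^ 2 := by positivity
  calc _ ≤ η ^ 2 * ((I.mean k - I.mean I.opt) ^ 2 / (I.mean I.opt * (1 - I.mean I.opt))) :=
        mul_le_mul_of_nonneg_left h hpos.le
    _ ≤ η ^ 2 * ((I.mean k - I.mean I.opt) ^ 2 / η ^ 2) := by gcongr
    _ = I.rewardGap k ^ 2 := by
        rw [Instance.rewardGap]
        field_simp
        ring

/-- The only use of the most-effective-competitor hypothesis: it bounds the information from a duel
with `l` by that from a duel with the optimal arm, scaled by the ratio of regrets, and the latter is
at most 4(Δᴰₖ)². -/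
theorem duelGap_mul_kl_le (I : Instance K) {k l : Fin K} (hk : I.IsMostEffective k I.opt)
    (hl : I.mean k < I.mean l) :
    kl (I.duel k l) (1 / 2) ≤ 4 * I.duelGap k * (I.duelGap k + I.duelGap l) := by
  have hne : k ≠ I.opt := fun h => by
    have := hk.1
    rw [← h] at this
    exact lt_irrefl _ this
  have hpos : ∀ l, I.mean k < I.mean l → 0 < kl (I.duel k l) (1 / 2) := fun l hl =>
    kl_pos (I.duel_mem k l) (by norm_num)
      (by linarith [I.duel_gt l k hl, I.duel_symm k l] : I.duel k l < 1 / 2).ne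
  have h := hk.2 l hl
  rw [Instance.duelCost, Instance.duelCost, I.duelGap_opt, add_zero,
    div_le_div_iff₀ (hpos _ hk.1) (hpos _ hl)] at h
  have hg := I.duelGap_pos hne
  have h2 := mul_le_mul_of_nonneg_left (kl_duel_opt_le I k)
    (add_nonneg hg.le (I.duelGap_nonneg l))
  refine le_of_mul_le_mul_left ?_ hg
  calc _ ≤ _ := h
    _ ≤ _ := h2
    _ = _ := by ring

/-- The two entries of the minimum in `armRate` serve the two kinds of feedback: α/Δᴿ for reward
pulls, (1-α)/Δᴰ for duels. The factor 1/8 turns the 4 of `duelGap_mul_kl_le` into the 1/2 of the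
duel regret. -/
theorem armRate_mul_explorationCost_le (I : Instance K) {η α : ℝ} (hη : 0 < η) (hα₀ : 0 ≤ α)
    (hα₁ : α ≤ 1) (h₁ : η ≤ I.mean I.opt) (h₂ : I.mean I.opt ≤ 1 - η) {k : Fin K}
    (hne : k ≠ I.opt) (hk : I.IsMostEffective k I.opt) (a : Action K) :
    min (η ^ 2) (1 / 8) * armRate I α k * explorationCost I k (kl (I.mean k) (I.mean I.opt))
        (fun l => kl (I.duel k l) (1 / 2)) a ≤
      explorationCost I k (α * I.rewardGap k)
        (fun l => (1 - α) * ((I.duelGap k + I.duelGap l) / 2)) a := by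
  have hr := I.rewardGap_pos hne
  have hd := I.duelGap_pos hne
  have hα' : 0 ≤ 1 - α := by linarith
  rw [← explorationCost_const_mul]
  refine explorationCost_mono I k ?_ (fun l hl => ?_) a
  · have hkl := (kl_pos (I.mean_mem k) (I.mean_mem I.opt) (I.mean_lt_opt hne).ne).le
    calc _ ≤ η ^ 2 * (α / I.rewardGap k) * kl (I.mean k) (I.mean I.opt) := by
          gcongr
          · exact armRate_nonneg I hα₀ hα₁ hne
          · exact min_le_left _ _
          · exact min_le_left _ _
      _ = α / I.rewardGap k * (η ^ 2 * kl (I.mean k) (I.mean I.opt)) := by ring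
      _ ≤ α / I.rewardGap k * I.rewardGap k ^ 2 := by
          gcongr
          exact kl_mean_opt_le I hη h₁ h₂ k
      _ = _ := by field_simp
  · have hkl := (kl_pos (I.duel_mem k l) (q := 1 / 2) (by norm_num)
      (by linarith [I.duel_gt l k hl, I.duel_symm k l] : I.duel k l < 1 / 2).ne).le
    calc _ ≤ 1 / 8 * ((1 - α) / I.duelGap k) * kl (I.duel k l) (1 / 2) := by
          gcongr
          · exact armRate_nonneg I hα₀ hα₁ hne
          · exact min_le_right _ _
          · exact min_le_right _ _
      _ ≤ 1 / 8 * ((1 - α) / I.duelGap k) * (4 * I.duelGap k * (I.duelGap k + I.duelGap l)) := by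
          gcongr
          exact duelGap_mul_kl_le I hk hl
      _ = _ := by
          field_simp
          ring

theorem eventually_log_le_expect_regret {A : Algorithm K} (hA : Consistent A) (I : Instance K)
    {η α : ℝ} (hη : 0 < η) (hα₀ : 0 ≤ α) (hα₁ : α ≤ 1) (h₁ : η ≤ I.mean I.opt)
    (h₂ : I.mean I.opt ≤ 1 - η) (hI : ∀ k, k ≠ I.opt → I.IsMostEffective k I.opt) :
    ∀ᶠ T : ℕ in atTop,
      (min (η ^ 2) (1 / 8) / 16 * ∑ k ∈ Finset.univ.erase I.opt, armRate I α k) * Real.log T ≤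
        expect I (A T) T fun h => regret I α h := by
  have hev : ∀ᶠ T : ℕ in atTop, ∀ k, k ≠ I.opt → Real.log T / 16 ≤
      expect I (A T) T fun h => ∑ s, explorationCost I k (kl (I.mean k) (I.mean I.opt))
        (fun l => kl (I.duel k l) (1 / 2)) (h s).action := by
    refine eventually_all.2 fun k => ?_
    by_cases hk : k = I.opt
    · simp [hk]
    · filter_upwards [eventually_log_le_expect_explorationCost hA I hk] with T h _ using h
  filter_upwards [hev] with T hT
  have hc : 0 ≤ min (η ^ 2) (1 / 8 : ℝ) := le_min (by positivity) (by norm_num)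
  calc _ = ∑ k ∈ Finset.univ.erase I.opt,
        min (η ^ 2) (1 / 8) * armRate I α k * (Real.log T / 16) := by
        rw [Finset.mul_sum, Finset.sum_mul]
        exact Finset.sum_congr rfl fun k _ => by ring
    _ ≤ ∑ k ∈ Finset.univ.erase I.opt, min (η ^ 2) (1 / 8) * armRate I α k *
          expect I (A T) T fun h => ∑ s, explorationCost I k (kl (I.mean k) (I.mean I.opt))
            (fun l => kl (I.duel k l) (1 / 2)) (h s).action :=
        Finset.sum_le_sum fun k hk => mul_le_mul_of_nonneg_left (hT k (Finset.ne_of_mem_erase hk))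
          (mul_nonneg hc (armRate_nonneg I hα₀ hα₁ (Finset.ne_of_mem_erase hk)))
    _ = expect I (A T) T fun h => ∑ k ∈ Finset.univ.erase I.opt,
          min (η ^ 2) (1 / 8) * armRate I α k *
            ∑ s, explorationCost I k (kl (I.mean k) (I.mean I.opt))
              (fun l => kl (I.duel k l) (1 / 2)) (h s).action := by
        simp only [expect_eq_pmfExp, pmfExp_sum, pmfExp_const_mul]
    _ ≤ _ := by
        refine pmfExp_mono _ fun h => ?_
        simp only [regret, rewardRegret, duelRegret, Finset.mul_sum]
        -- Exchanging the sums over arms and rounds reduces the claim to a single action.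
        rw [Finset.sum_comm, ← Finset.sum_add_distrib]
        refine Finset.sum_le_sum fun s _ => ?_
        refine le_trans (Finset.sum_le_sum fun k hk => ?_)
          (sum_explorationCost_le I hα₁ (h s).action)
        have hk := Finset.ne_of_mem_erase hk
        exact armRate_mul_explorationCost_le I hη hα₀ hα₁ h₁ h₂ hk (hI k hk) _

/-- Inversion in `[0, ∞]` turns the maximum into a minimum. A zero weight α or 1-α makes its
quotient ∞, whose inverse 0 matches the real quotient in `armRate`. -/
theorem one_div_max_le_ofReal_armRate (I : Instance K) (α : ℝ) {k : Fin K} (hk : k ≠ I.opt) :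
    1 / max (ENNReal.ofReal (I.rewardGap k) / ENNReal.ofReal α)
        (ENNReal.ofReal (I.duelGap k) / ENNReal.ofReal (1 - α)) ≤
      ENNReal.ofReal (armRate I α k) := by
  have hinv : ∀ {d : ℝ} (b : ℝ), 0 < d →
      1 / (ENNReal.ofReal d / ENNReal.ofReal b) = ENNReal.ofReal (b / d) := fun b hd => by
    rw [one_div, ENNReal.inv_div (Or.inl ENNReal.ofReal_ne_top)
      (Or.inr (ENNReal.ofReal_pos.2 hd).ne'), ENNReal.ofReal_div_of_pos hd]
  rw [armRate, ENNReal.ofReal_min, ← hinv _ (I.rewardGap_pos hk), ← hinv _ (I.duelGap_pos hk)]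
  exact le_min (ENNReal.div_le_div_left (le_max_left _ _) _)
    (ENNReal.div_le_div_left (le_max_right _ _) _)

end exploration

end DRMAB

/-- The bound is stated in `[0, ∞]`: the normalized expected regret is nonnegative for `T ≥ 1`, the
lower limit may be infinite, and `x / 0 = ∞` for `x > 0`, `1 / ∞ = 0` there. -/
theorem mainTheorem2 :
    ∀ η : ℝ, 0 < η → ∃ C : ℝ, 0 < C ∧
      ∀ (K : ℕ) [NeZero K] (A : DRMAB.Algorithm K), DRMAB.Consistent A →
      ∀ α : ℝ, 0 ≤ α → α ≤ 1 →
      ∀ I : DRMAB.Instance K, η ≤ I.mean I.opt → I.mean I.opt ≤ 1 - η →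
        (∀ k, k ≠ I.opt → I.IsMostEffective k I.opt) →
        ENNReal.ofReal C * ∑ k ∈ Finset.univ.erase I.opt,
            1 / max (ENNReal.ofReal (I.rewardGap k) / ENNReal.ofReal α)
              (ENNReal.ofReal (I.duelGap k) / ENNReal.ofReal (1 - α)) ≤
          Filter.liminf (fun T : ℕ =>
            ENNReal.ofReal
              (DRMAB.expect I (A T) T (fun h => DRMAB.regret I α h) / Real.log T))
            Filter.atTop := by
  intro η hη
  have hC : 0 < min (η ^ 2) (1 / 8 : ℝ) / 16 :=
    div_pos (lt_min (by positivity) (by norm_num)) (by norm_num)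
  refine ⟨_, hC, fun K _ A hA α hα₀ hα₁ I h₁ h₂ hI => ?_⟩
  refine le_trans (mul_le_mul_right (Finset.sum_le_sum fun k hk =>
    DRMAB.one_div_max_le_ofReal_armRate I α (Finset.ne_of_mem_erase hk)) _) ?_
  rw [← ENNReal.ofReal_sum_of_nonneg fun k hk =>
    DRMAB.armRate_nonneg I hα₀ hα₁ (Finset.ne_of_mem_erase hk), ← ENNReal.ofReal_mul hC.le]
  refine Filter.le_liminf_of_le (by isBoundedDefault) ?_
  filter_upwards [DRMAB.eventually_log_le_expect_regret hA I hη hα₀ hα₁ h₁ h₂ hI,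
    Filter.eventually_gt_atTop 1] with T hT hT1
  have hlog : 0 < Real.log T := Real.log_pos (by exact_mod_cast hT1)
  exact ENNReal.ofReal_le_ofReal ((le_div_iff₀ hlog).2 hT)
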